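/- Throughout, bounded linear operators $A$ on $\ell^2(\mathbb{Z})$ (complex scalars) are identified with their matrices $A_{i,j}=\langle Ae_j,e_i\rangle$ with respect to the standard orthonormal basis $(e_j)_{j\in\mathbb{Z}}$, and $$N(A):=\operatorname{clos}\{\langle Ax,x\rangle : x\in\ell^2(\mathbb{Z}),\ \|x\|=1\}$$ denotes the (closed) numerical range. Let $\sigma\in(0,1]$ and let $M(\{1\},\{0\},\{\pm\sigma\})$ be the set of all bounded operators $A$ on $\ell^2(\mathbb{Z})$ such that, for all $j\in\mathbb{Z}$, $A_{j-1,j}=1$, $A_{j,j}=0$, $A_{j+1,j}\in\{\sigma,-\sigma\}$, and all other entries of $A$ vanish. Let $M_{fin}(\{1\},\{0\},\{\pm\sigma\})$ be the set of all finite square matrices with the same property. An operator $A\in M(\{1\},\{0\},\{\pm\sigma\})$ is called pseudo-ergodic if for every $\epsilon>0$ and every $B\in M_{fin}(\{1\},\{0\},\{\pm\sigma\})$ there are integers $k,l$ such that the matrix $(A_{i,j})_{k\le i,j\le l}$ has the same size as $B$ and differs from $B$ by at most $\epsilon$ in operator norm. For $w=(w_0,w_1,w_2,w_3)\in\{\pm\sigma\}^4$,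 the $4$-periodic operator with period $w$ is the operator $B\in M(\{1\},\{0\},\{\pm\sigma\})$ with $B_{j+1,j}=w_{j \bmod 4}$ for all $j\in\mathbb{Z}$. **Theorem.** Let $\sigma\in(0,1]$ and let $B_1$, $B_2$, $B_3$ be the $4$-periodic operators with periods $(\sigma,\sigma,\sigma,\sigma)$, $(-\sigma,-\sigma,\sigma,\sigma)$ and $(-\sigma,-\sigma,-\sigma,-\sigma)$, respectively. Then for every $A\in M(\{1\},\{0\},\{\pm\sigma\})$, $$N(A^2)\subseteq\operatorname{conv}\bigl(N(B_1^2)\cup N(B_2^2)\cup N(B_3^2)\bigr).$$ If $A$ is moreover pseudo-ergodic, then equality holds. -/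

import Mathlib

open scoped lp

noncomputable section

/-- Bounded linear operators on `ℓ²(ℤ)` with complex scalars. -/
abbrev Op : Type := ℓ²(ℤ, ℂ) →L[ℂ] ℓ²(ℤ, ℂ)

/-- The standard orthonormal basis vector `e_j` of `ℓ²(ℤ)`. -/
def stdVec (j : ℤ) : ℓ²(ℤ, ℂ) := lp.single 2 j (1 : ℂ)

/-- The matrix entry `A_{i,j} = ⟨A e_j, e_i⟩`, that is, the `i`-th coordinate of `A e_j`. -/
def entry (A : Op) (i j : ℤ) : ℂ := (A (stdVec j) : ℤ → ℂ) i

/-- The (closed) numerical range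
`N(A) = clos {⟨A x, x⟩ : ‖x‖ = 1}`. Mathlib's inner product is linear in its second argument. -/
def numRange (A : Op) : Set ℂ :=
  closure {z : ℂ | ∃ x : ℓ²(ℤ, ℂ), ‖x‖ = 1 ∧ z = inner ℂ x (A x)}

/-- `M(U_n, …, U_m)`: bounded operators whose `k`-th diagonal `(A_{i+k,i})_i` has all its entries
in `U_k` for `n ≤ k ≤ m`, and vanishes for all other `k`. -/
def bandClass (n m : ℤ) (U : ℤ → Set ℂ) : Set Op :=
  {A | ∀ k i : ℤ,
    (n ≤ k ∧ k ≤ m → entry A (i + k) i ∈ U k) ∧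
    (¬(n ≤ k ∧ k ≤ m) → entry A (i + k) i = 0)}

/-- `M_fin(U_n, …, U_m)` in size `N`: finite square matrices with the same property. -/
def finBandClass (n m : ℤ) (U : ℤ → Set ℂ) (N : ℕ) : Set (Matrix (Fin N) (Fin N) ℂ) :=
  {B | ∀ i j : Fin N,
    (n ≤ (i : ℤ) - (j : ℤ) ∧ (i : ℤ) - (j : ℤ) ≤ m → B i j ∈ U ((i : ℤ) - (j : ℤ))) ∧
    (¬(n ≤ (i : ℤ) - (j : ℤ) ∧ (i : ℤ) - (j : ℤ) ≤ m) → B i j = 0)}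

/-- `M_{per,p}(U_n, …, U_m)`: the `p`-periodic operators of `M(U_n, …, U_m)`. -/
def perBandClass (p : ℕ) (n m : ℤ) (U : ℤ → Set ℂ) : Set Op :=
  {A | A ∈ bandClass n m U ∧ ∀ i j : ℤ, entry A i j = entry A (i + p) (j + p)}

/-- The `N × N` diagonal block of `A` with rows and columns `k, k + 1, …, k + N - 1`, that is, the
matrix of `P_{k,l} A P_{k,l}` on `span {e_k, …, e_l}` with `l = k + N - 1`. -/
def diagBlock (A : Op) (k : ℤ) (N : ℕ) : Matrix (Fin N) (Fin N) ℂ :=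
  Matrix.of fun i j => entry A (k + (i : ℤ)) (k + (j : ℤ))

/-- `ΨE(U_n, …, U_m)`: the pseudo-ergodic operators of `M(U_n, …, U_m)`: every finite square
matrix of the class is found, up to `ε` in the operator norm of the Euclidean norm, as a diagonal
block of `A`. -/
def pseudoErgodic (n m : ℤ) (U : ℤ → Set ℂ) : Set Op :=
  {A | A ∈ bandClass n m U ∧
    ∀ ε : ℝ, 0 < ε → ∀ N : ℕ, ∀ B ∈ finBandClass n m U N,
      ∃ k : ℤ, ‖Matrix.toEuclideanCLM (n := Fin N) (𝕜 := ℂ) (diagBlock A k N - B)‖ ≤ ε}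

/-- The sets `U_{-1} = {1}`, `U_0 = {0}`, `U_1 = {σ, -σ}`; the other values play no role. -/
def hopSets (σ : ℝ) : ℤ → Set ℂ := fun k =>
  if k = -1 then {1} else if k = 0 then {0} else if k = 1 then {(σ : ℂ), -(σ : ℂ)} else {0}

/-- The entry at index `j` of the `4`-periodic sequence with period `w`. -/
def perSeq (w : Fin 4 → ℂ) (j : ℤ) : ℂ :=
  w ⟨(j % 4).toNat, by omega⟩

lemma perSeq_norm_le (w : Fin 4 → ℂ) (j : ℤ) : ‖perSeq w j‖ ≤ ‖w‖ := norm_le_pi_norm w _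

lemma perSeq_add_four (w : Fin 4 → ℂ) (j : ℤ) : perSeq w (j + 4) = perSeq w j := by
  simp [perSeq]

/-- A square-summable sequence, reindexed by a permutation of `ℤ` and multiplied by a bounded
sequence, is square-summable. -/
lemma memlp_weighted (c : ℤ → ℂ) (C : ℝ) (hc : ∀ i, ‖c i‖ ≤ C) (e : ℤ ≃ ℤ) (x : ℓ²(ℤ, ℂ)) :
    Memℓp (fun i => c i * (x : ℤ → ℂ) (e i)) 2 := by
  have hx : Memℓp (fun i => (x : ℤ → ℂ) (e i)) 2 := by
    have h := (lp.memℓp x).summable (by norm_num)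
    exact memℓp_gen ((e.summable_iff).2 h)
  have hC : Memℓp (fun i => (C : ℂ) * (x : ℤ → ℂ) (e i)) 2 := hx.const_mul (C : ℂ)
  refine memℓp_gen (Summable.of_nonneg_of_le (fun i => by positivity) (fun i => ?_)
    (hC.summable (by norm_num)))
  have h0 : 0 ≤ C := (norm_nonneg _).trans (hc 0)
  refine Real.rpow_le_rpow (norm_nonneg _) ?_ (by norm_num)
  rw [norm_mul, norm_mul, Complex.norm_real, Real.norm_of_nonneg h0]
  exact mul_le_mul_of_nonneg_right (hc i) (norm_nonneg _)

/-- The bounded operator `(T x)_i = c_i x_{e(i)}`, for a bounded sequence `c` and a permutation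
`e` of `ℤ`. -/
def weightedPerm (c : ℤ → ℂ) (C : ℝ) (hc : ∀ i, ‖c i‖ ≤ C) (e : ℤ ≃ ℤ) : Op :=
  LinearMap.mkContinuous
    { toFun := fun x => ⟨fun i => c i * (x : ℤ → ℂ) (e i), memlp_weighted c C hc e x⟩
      map_add' := fun x y => by
        ext i
        exact mul_add _ _ _
      map_smul' := fun a x => by
        ext i
        exact mul_left_comm _ _ _ } C (fun x => by
    have h0 : 0 ≤ C := (norm_nonneg _).trans (hc 0)
    refine lp.norm_le_of_tsum_le (by norm_num) (by positivity) ?_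
    have hx := (lp.memℓp x).summable (by norm_num)
    have hC := (hx.mul_left (C ^ (2 : ENNReal).toReal))
    have hs := (memlp_weighted c C hc e x).summable (by norm_num)
    have hxe := (e.summable_iff).2 hC
    rw [Real.mul_rpow h0 (norm_nonneg _), lp.norm_rpow_eq_tsum (by norm_num) x, ← tsum_mul_left,
      ← e.tsum_eq (fun i => C ^ (2 : ENNReal).toReal *
        ‖(x : ℤ → ℂ) i‖ ^ (2 : ENNReal).toReal)]
    refine hs.tsum_le_tsum (fun i => ?_) hxe
    rw [← Real.mul_rpow h0 (norm_nonneg _)]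
    refine Real.rpow_le_rpow (norm_nonneg _) ?_ (by norm_num)
    change ‖c i * (x : ℤ → ℂ) (e i)‖ ≤ _
    rw [norm_mul]
    exact mul_le_mul_of_nonneg_right (hc i) (norm_nonneg _))

lemma weightedPerm_apply (c : ℤ → ℂ) (C : ℝ) (hc : ∀ i, ‖c i‖ ≤ C) (e : ℤ ≃ ℤ)
    (x : ℓ²(ℤ, ℂ)) (i : ℤ) :
    (weightedPerm c C hc e x : ℤ → ℂ) i = c i * (x : ℤ → ℂ) (e i) := rfl

/-- The `4`-periodic operator with period `w = (w_0, w_1, w_2, w_3)`: the tridiagonal operator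
`(B x)_i = x_{i+1} + h_{i-1} x_{i-1}` with `h_j = w_{j mod 4}`, so that its superdiagonal is
constant `1`, its main diagonal is `0`, and its subdiagonal is `B_{j+1,j} = h_j`. -/
def perOp (w : Fin 4 → ℂ) : Op :=
  weightedPerm (fun _ => 1) 1 (fun _ => by simp) (Equiv.addRight 1) +
    weightedPerm (fun i => perSeq w (i - 1)) ‖w‖ (fun i => perSeq_norm_le w (i - 1))
      (Equiv.addRight (-1))

/-- The action of `perOp` in coordinates. -/
lemma perOp_apply (w : Fin 4 → ℂ) (x : ℓ²(ℤ, ℂ)) (i : ℤ) :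
    (perOp w x : ℤ → ℂ) i =
      (x : ℤ → ℂ) (i + 1) + perSeq w (i - 1) * (x : ℤ → ℂ) (i - 1) := by
  change (weightedPerm _ _ _ _ x : ℤ → ℂ) i + (weightedPerm _ _ _ _ x : ℤ → ℂ) i = _
  rw [weightedPerm_apply, weightedPerm_apply]
  simp [sub_eq_add_neg]

/-- The matrix of `perOp`. -/
lemma entry_perOp (w : Fin 4 → ℂ) (i j : ℤ) :
    entry (perOp w) i j =
      (if i = j - 1 then 1 else 0) + (if i = j + 1 then perSeq w j else 0) := by
  rw [entry, perOp_apply, stdVec, lp.single_apply, lp.single_apply]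
  simp only [Pi.single_apply, mul_ite, mul_one, mul_zero]
  congr 1
  · exact if_congr (by omega) rfl rfl
  · by_cases h : i = j + 1
    · subst h
      simp
    · rw [if_neg (by omega), if_neg h]

/-- If the period takes values in `{σ, -σ}`, then `perOp` is in `M_{per,4}({1}, {0}, {±σ})`. -/
lemma perOp_mem (σ : ℝ) (w : Fin 4 → ℂ) (hw : ∀ k, w k = σ ∨ w k = -σ) :
    perOp w ∈ perBandClass 4 (-1) 1 (hopSets σ) := by
  refine ⟨fun k i => ⟨fun hk => ?_, fun hk => ?_⟩, fun i j => ?_⟩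
  · rw [entry_perOp]
    obtain rfl | rfl | rfl : k = -1 ∨ k = 0 ∨ k = 1 := by omega
    · rw [if_pos (by omega), if_neg (by omega)]
      simp [hopSets]
    · rw [if_neg (by omega), if_neg (by omega)]
      simp [hopSets]
    · rw [if_neg (by omega), if_pos rfl]
      have h : perSeq w i = σ ∨ perSeq w i = -σ := hw _
      simpa [hopSets] using h
  · rw [entry_perOp, if_neg (by omega), if_neg (by omega), add_zero]
  · rw [entry_perOp, entry_perOp]
    have h : perSeq w (j + (4 : ℕ)) = perSeq w j := perSeq_add_four w j
    rw [h]
    congr 1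
    · exact if_congr (by push_cast; omega) rfl rfl
    · exact if_congr (by push_cast; omega) rfl rfl

end

/-! Write `h` for the subdiagonal of `A`. Then `A ^ 2` couples only sites at distance two, and its
quadratic form is a sum over the links `(i, i + 2)` of two-variable forms in `x i`, `x (i + 2)` that
involve only the signs of `h i` and `h (i + 1)`. The diagonal weight `h i + h (i - 1)` at site `i`
is shared between the two links meeting there.

In direction `w`, a link with equal signs is bounded by the support function of an ellipse centred
at `2 * σ` or `-2 * σ`, and a link with opposite signs by that of the disc of radius `1 + σ ^ 2`
about `0` (`link_le`). Each site lies on two links, so summing bounds the support function of the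
numerical range (`re_sqForm_le`).

Conversely, truncated plane waves on the odd sites place the boundary curves of the two ellipses in
the ranges for the two constant periods, and the circle in the range for the mixed period
(`add_ellipse_mem`, `circle_mem`). Hahn–Banach separation from the compact hull gives the inclusion.

For equality, the form values at finitely supported unit vectors, over all sign patterns, make up a
convex set, because two patterns can be placed far apart in a single one (`convex_finValues`). Its
closure contains the three periodic ranges, and a pseudo-ergodic `A` realises all these values since
it contains every finite pattern. -/

noncomputable section

open ComplexConjugate

/-! ### Tridiagonal operators in coordinates and the form of their squares -/

/-- The action of the square of the tridiagonal operator with superdiagonal `1` and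
subdiagonal `h`. -/
def sqAct (h x : ℤ → ℂ) (i : ℤ) : ℂ :=
  x (i + 2) + (h i + h (i - 1)) * x i + h (i - 1) * h (i - 2) * x (i - 2)

/-- The quadratic form `⟨A² x, x⟩` of the tridiagonal operator with superdiagonal `1` and
subdiagonal `h`. -/
def sqForm (h x : ℤ → ℂ) : ℂ := ∑' i, conj (x i) * sqAct h x i

/-- `A` is the tridiagonal operator with superdiagonal `1`, diagonal `0` and subdiagonal `h`. -/
def HasSubdiag (A : Op) (h : ℤ → ℂ) : Prop :=
  ∀ (x : ℓ²(ℤ, ℂ)) (i : ℤ), (A x : ℤ → ℂ) i = (x : ℤ → ℂ) (i + 1) + h (i - 1) * (x : ℤ → ℂ) (i - 1)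

lemma hasSubdiag_perOp (w : Fin 4 → ℂ) : HasSubdiag (perOp w) (perSeq w) := perOp_apply w

/-- Expand `x` in the standard basis and apply the continuous functional `y ↦ (A y) i`. This turns
hypotheses on matrix entries into a coordinate formula for `A`. -/
lemma hasSum_entry (A : Op) (x : ℓ²(ℤ, ℂ)) (i : ℤ) :
    HasSum (fun j => (x : ℤ → ℂ) j * entry A i j) ((A x : ℤ → ℂ) i) := by
  have h1 : HasSum (fun j => lp.single 2 j ((x : ℤ → ℂ) j)) x :=
    lp.hasSum_single (by norm_num) x
  have h2 := h1.mapL ((lp.evalCLM ℂ (fun _ : ℤ => ℂ) 2 i).comp A)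
  refine Eq.mp (congrArg (HasSum · _) (funext fun j => ?_)) h2
  have : lp.single 2 j ((x : ℤ → ℂ) j) = (x : ℤ → ℂ) j • stdVec j := by
    rw [stdVec, ← lp.single_smul]
    simp
  change (A (lp.single 2 j ((x : ℤ → ℂ) j)) : ℤ → ℂ) i = _
  rw [this, map_smul]
  rfl

lemma hasSubdiag_of_mem {σ : ℝ} {A : Op} (hA : A ∈ bandClass (-1) 1 (hopSets σ)) :
    HasSubdiag A (fun j => entry A (j + 1) j) := by
  intro x i
  have h1 := hasSum_entry A x i
  have h2 : HasSum (fun j => (x : ℤ → ℂ) j * entry A i j)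
      (∑ j ∈ {i + 1, i - 1}, (x : ℤ → ℂ) j * entry A i j) := by
    refine hasSum_sum_of_ne_finset_zero fun j hj => ?_
    simp only [Finset.mem_insert, Finset.mem_singleton, not_or] at hj
    have h3 := hA (i - j) j
    rw [show j + (i - j) = i by ring] at h3
    by_cases hij : i = j
    · subst hij
      have := h3.1 (by omega)
      simp only [hopSets, sub_self] at this
      simp at this
      simp [this]
    · rw [h3.2 (by omega), mul_zero]
  rw [h1.unique h2, Finset.sum_pair (by omega)]
  have h4 := (hA (-1) (i + 1)).1 (by omega)
  rw [show i + 1 + -1 = i by ring] at h4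
  simp only [hopSets, if_true, Set.mem_singleton_iff] at h4
  change _ = (x : ℤ → ℂ) (i + 1) + entry A (i - 1 + 1) (i - 1) * (x : ℤ → ℂ) (i - 1)
  rw [h4, show i - 1 + 1 = i by ring]
  ring

lemma entry_eq_or_neg {σ : ℝ} {A : Op} (hA : A ∈ bandClass (-1) 1 (hopSets σ)) (j : ℤ) :
    entry A (j + 1) j = σ ∨ entry A (j + 1) j = -σ := by
  have := (hA 1 j).1 (by omega)
  simpa [hopSets] using this

lemma HasSubdiag.sq_apply {A : Op} {h : ℤ → ℂ} (hA : HasSubdiag A h) (x : ℓ²(ℤ, ℂ)) (i : ℤ) :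
    ((A ^ 2) x : ℤ → ℂ) i = sqAct h x i := by
  rw [pow_two, mul_apply_eq_comp, hA, hA, hA, sqAct]
  rw [show i + 1 + 1 = i + 2 by ring, show i + 1 - 1 = i by ring, show i - 1 + 1 = i by ring,
    show i - 1 - 1 = i - 2 by ring]
  ring

lemma HasSubdiag.inner_sq {A : Op} {h : ℤ → ℂ} (hA : HasSubdiag A h) (x : ℓ²(ℤ, ℂ)) :
    inner ℂ x ((A ^ 2) x) = sqForm h x := by
  rw [lp.inner_eq_tsum, sqForm]
  refine tsum_congr fun i => ?_
  rw [hA.sq_apply, RCLike.inner_apply, mul_comm]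

/-! ### Upper bound for the support function -/

/-- The contribution of one link: `a`, `b` are the moduli at its two ends, `z` is the product of the
conjugate of the first value with the second, and `u`, `v` are the subdiagonal entries. `h1` serves
equal signs and `h2` opposite signs. -/
lemma link_le {σ : ℝ} (w z u v : ℂ) (a b M : ℝ) (hz : ‖z‖ = a * b)
    (hu : u = σ ∨ u = -σ) (hv : v = σ ∨ v = -σ) (hσ : 0 ≤ σ)
    (h1 : 2 * σ * |w.re| + ‖conj w + σ ^ 2 * w‖ ≤ M) (h2 : (1 + σ ^ 2) * ‖w‖ ≤ M) :
    (conj w * (z + u * (a ^ 2 : ℝ) + (v * (b ^ 2 : ℝ) + v * u * conj z))).re ≤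
      M / 2 * (a ^ 2 + b ^ 2) := by
  have hsame : ∀ s : ℝ, s = 1 ∨ s = -1 →
      (conj w * (z + (s * σ : ℝ) * (a ^ 2 : ℝ) + ((s * σ : ℝ) * (b ^ 2 : ℝ) +
        (s * σ : ℝ) * (s * σ : ℝ) * conj z))).re ≤ M / 2 * (a ^ 2 + b ^ 2) := by
    intro s hs
    have hs2 : s * s = 1 := by rcases hs with rfl | rfl <;> norm_num
    -- Since `conj w * conj z` and `w * z` have the same real part, the two off-diagonal terms merge
    -- into one.
    have e : (conj w * (z + (s * σ : ℝ) * (a ^ 2 : ℝ) + ((s * σ : ℝ) * (b ^ 2 : ℝ) +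
        (s * σ : ℝ) * (s * σ : ℝ) * conj z))).re =
        ((conj w + σ ^ 2 * w) * z).re + σ * (s * w.re) * (a ^ 2 + b ^ 2) := by
      simp only [pow_two, Complex.add_re, Complex.mul_re, Complex.mul_im, Complex.conj_re,
        Complex.conj_im, Complex.add_im, Complex.ofReal_re, Complex.ofReal_im]
      linear_combination (σ * σ * (w.re * z.re - w.im * z.im)) * hs2
    have e1 : ((conj w + σ ^ 2 * w) * z).re ≤ ‖conj w + σ ^ 2 * w‖ * (a * b) := by
      rw [← hz, ← norm_mul]
      exact Complex.re_le_norm _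
    have e2 : s * w.re ≤ |w.re| := by
      rcases hs with rfl | rfl
      · rw [one_mul]; exact le_abs_self _
      · rw [neg_one_mul]; exact neg_le_abs _
    have e3 : σ * (s * w.re) * (a ^ 2 + b ^ 2) ≤ σ * |w.re| * (a ^ 2 + b ^ 2) := by gcongr
    have e4 : ‖conj w + σ ^ 2 * w‖ * (a * b) ≤ ‖conj w + σ ^ 2 * w‖ * ((a ^ 2 + b ^ 2) / 2) := by
      gcongr
      nlinarith [sq_nonneg (a - b)]
    rw [e]
    nlinarith [mul_le_mul_of_nonneg_right h1 (by positivity : 0 ≤ (a ^ 2 + b ^ 2) / 2)]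
  have hopp : ∀ s : ℝ, s = 1 ∨ s = -1 →
      (conj w * (z + (s * σ : ℝ) * (a ^ 2 : ℝ) + ((-s * σ : ℝ) * (b ^ 2 : ℝ) +
        (-s * σ : ℝ) * (s * σ : ℝ) * conj z))).re ≤ M / 2 * (a ^ 2 + b ^ 2) := by
    intro s hs
    have hs2 : s * s = 1 := by rcases hs with rfl | rfl <;> norm_num
    have e : (conj w * (z + (s * σ : ℝ) * (a ^ 2 : ℝ) + ((-s * σ : ℝ) * (b ^ 2 : ℝ) +
        (-s * σ : ℝ) * (s * σ : ℝ) * conj z))).re =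
        ((conj w - σ ^ 2 * w) * z).re + σ * (s * w.re) * (a ^ 2 - b ^ 2) := by
      simp only [pow_two, Complex.add_re, Complex.mul_re, Complex.mul_im, Complex.conj_re,
        Complex.conj_im, Complex.add_im, Complex.sub_re, Complex.sub_im, Complex.ofReal_re,
        Complex.ofReal_im]
      linear_combination (-(σ * σ * (w.re * z.re - w.im * z.im))) * hs2
    have e1 : ((conj w - σ ^ 2 * w) * z).re ≤ ‖conj w - σ ^ 2 * w‖ * (a * b) := by
      rw [← hz, ← norm_mul]
      exact Complex.re_le_norm _
    have e2 : ‖conj w - σ ^ 2 * w‖ ^ 2 + (2 * σ * (s * w.re)) ^ 2 = ((1 + σ ^ 2) * ‖w‖) ^ 2 := by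
      rw [mul_pow _ ‖w‖, Complex.sq_norm, Complex.sq_norm, Complex.normSq_apply,
        Complex.normSq_apply]
      simp only [pow_two, Complex.sub_re, Complex.mul_re, Complex.mul_im, Complex.conj_re,
        Complex.conj_im, Complex.sub_im, Complex.ofReal_re, Complex.ofReal_im]
      linear_combination (4 * σ * σ * w.re * w.re) * hs2
    set p := ‖conj w - σ ^ 2 * w‖
    set r := 2 * σ * (s * w.re)
    set R := (1 + σ ^ 2) * ‖w‖
    have hR : 0 ≤ R := by positivity
    -- Cauchy–Schwarz for `(p, r)`, of length `R`, against `(a * b, (a ^ 2 - b ^ 2) / 2)`, of length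
    -- `(a ^ 2 + b ^ 2) / 2`; the square below is the defect in Lagrange's identity.
    have e3 : p * (a * b) + r / 2 * (a ^ 2 - b ^ 2) ≤ R / 2 * (a ^ 2 + b ^ 2) := by
      refine abs_le_of_sq_le_sq' ?_ (by positivity) |>.2
      rw [← sub_nonneg]
      convert sq_nonneg (p * (a ^ 2 - b ^ 2) / 2 - r * (a * b)) using 1
      linear_combination (-((a ^ 2 + b ^ 2) ^ 2) / 4) * e2
    rw [e]
    nlinarith [mul_le_mul_of_nonneg_right h2 (by positivity : 0 ≤ (a ^ 2 + b ^ 2) / 2)]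
  rcases hu with rfl | rfl <;> rcases hv with rfl | rfl
  · simpa using hsame 1 (Or.inl rfl)
  · simpa using hopp 1 (Or.inl rfl)
  · simpa using hopp (-1) (Or.inr rfl)
  · simpa using hsame (-1) (Or.inr rfl)

lemma norm_sq_hasSum (x : ℓ²(ℤ, ℂ)) : HasSum (fun i => ‖(x : ℤ → ℂ) i‖ ^ 2) (‖x‖ ^ 2) := by
  have := lp.hasSum_norm (p := 2) (by norm_num) x
  simpa using this

/-- The support function of the numerical range of the square of an operator with entries
`±σ` on the subdiagonal is bounded by that of two ellipses and a disc. -/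
lemma re_sqForm_le {σ : ℝ} (hσ : 0 ≤ σ) {h : ℤ → ℂ} (hh : ∀ j, h j = σ ∨ h j = -σ) (w : ℂ) (M : ℝ)
    (h1 : 2 * σ * |w.re| + ‖conj w + σ ^ 2 * w‖ ≤ M) (h2 : (1 + σ ^ 2) * ‖w‖ ≤ M)
    (x : ℓ²(ℤ, ℂ)) : (conj w * sqForm h x).re ≤ M * ‖x‖ ^ 2 := by
  have hn : ∀ j, ‖h j‖ ≤ σ := by
    intro j
    rcases hh j with e | e <;> rw [e] <;> simp [abs_of_nonneg hσ]
  have hnn : ∀ j, ‖h (j - 1) * h (j - 2)‖ ≤ σ * σ := fun j => by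
    rw [norm_mul]
    exact mul_le_mul (hn _) (hn _) (norm_nonneg _) hσ
  set X : ℤ → ℂ := (x : ℤ → ℂ)
  have hre : ∀ f : ℤ → ℂ, Summable f → Summable fun i => (conj w * f i).re := fun f hf =>
    (hf.mul_left (conj w)).mapL Complex.reCLM
  have hsum : ∀ y : ℓ²(ℤ, ℂ), Summable fun i => conj (X i) * (y : ℤ → ℂ) i := fun y => by
    refine (lp.summable_inner (𝕜 := ℂ) x y).congr fun i => ?_
    rw [RCLike.inner_apply, mul_comm]
  -- Each summand is cut into its forward half (`x (i + 2)` and `h i`) and its backward half (`x (i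
  -- - 2)` and `h (i - 1)`). Shifting the backward halves by two makes both halves of a link share
  -- one index.
  have hP := hsum (weightedPerm (fun _ => 1) 1 (fun _ => by simp) (Equiv.addRight 2) x +
    weightedPerm h σ hn (Equiv.refl _) x)
  have hQ := hsum (weightedPerm (fun j => h (j - 1)) σ (fun j => hn _) (Equiv.refl _) x +
    weightedPerm (fun j => h (j - 1) * h (j - 2)) (σ * σ) hnn (Equiv.addRight (-2)) x)
  simp only [lp.coeFn_add, Pi.add_apply, weightedPerm_apply, Equiv.refl_apply,
    Equiv.coe_addRight, one_mul] at hP hQ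
  have hPQ : sqForm h X = (∑' i, conj (X i) * (X (i + 2) + h i * X i)) +
      ∑' i, conj (X i) * (h (i - 1) * X i + h (i - 1) * h (i - 2) * X (i + -2)) := by
    rw [← hP.tsum_add hQ, sqForm]
    refine tsum_congr fun i => ?_
    rw [sqAct, ← sub_eq_add_neg]
    ring
  have hQ' := (Equiv.addRight (2 : ℤ)).summable_iff.2 hQ
  rw [← (Equiv.addRight (2 : ℤ)).tsum_eq
    (fun i => conj (X i) * (h (i - 1) * X i + h (i - 1) * h (i - 2) * X (i + -2)))] at hPQ
  change Summable fun i => conj (X (i + 2)) * (h (i + 2 - 1) * X (i + 2) +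
    h (i + 2 - 1) * h (i + 2 - 2) * X (i + 2 + -2)) at hQ'
  change sqForm h X = _ + ∑' i, conj (X (i + 2)) * (h (i + 2 - 1) * X (i + 2) +
    h (i + 2 - 1) * h (i + 2 - 2) * X (i + 2 + -2)) at hPQ
  rw [← hP.tsum_add hQ'] at hPQ
  have hS := hP.add hQ'
  have key := ((hS.hasSum.mul_left (conj w)).mapL Complex.reCLM)
  rw [← hPQ] at key
  have hx := norm_sq_hasSum x
  have hx2 := (Equiv.addRight (2 : ℤ)).hasSum_iff.2 hx
  have hM := (hx.add hx2).mul_left (M / 2)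
  have := hasSum_le (fun i => ?_) key hM
  · refine this.trans (le_of_eq ?_)
    ring
  · have := link_le (σ := σ) w (conj (X i) * X (i + 2)) (h i) (h (i + 1)) ‖X i‖ ‖X (i + 2)‖ M
      (by simp) (hh _) (hh _) hσ h1 h2
    refine le_trans (le_of_eq ?_) this
    change (conj w * _).re = _
    congr 2
    rw [show i + 2 - 1 = i + 1 by ring, show i + 2 - 2 = i by ring, show i + 2 + -2 = i by ring]
    rw [Complex.ofReal_pow, Complex.ofReal_pow, ← Complex.conj_mul', ← Complex.conj_mul']
    simp only [map_mul, Complex.conj_conj]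
    ring

/-! ### Finitely supported test vectors -/

/-- A finitely supported sequence as an element of `ℓ²(ℤ)`. -/
def finSeq (x : ℤ → ℂ) (hx : x.support.Finite) : ℓ²(ℤ, ℂ) :=
  ⟨x, memℓp_gen (summable_of_hasFiniteSupport (hx.subset fun i hi => by
    contrapose! hi
    simp [Function.notMem_support.1 hi]))⟩

lemma finSeq_norm_sq (x : ℤ → ℂ) (hx : x.support.Finite) :
    ‖finSeq x hx‖ ^ 2 = ∑' i, ‖x i‖ ^ 2 :=
  (norm_sq_hasSum (finSeq x hx)).tsum_eq.symm

lemma sqForm_const_mul (h x : ℤ → ℂ) (c : ℂ) :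
    sqForm h (fun i => c * x i) = (‖c‖ ^ 2 : ℝ) * sqForm h x := by
  rw [sqForm, sqForm, ← tsum_mul_left]
  refine tsum_congr fun i => ?_
  rw [Complex.ofReal_pow, ← Complex.conj_mul', map_mul, sqAct, sqAct]
  ring

lemma support_const_mul_finite {x : ℤ → ℂ} (hx : x.support.Finite) (c : ℂ) :
    (fun i => c * x i).support.Finite :=
  hx.subset fun i hi => by
    rw [Function.mem_support] at hi ⊢
    exact right_ne_zero_of_mul hi

lemma HasSubdiag.sqForm_mem {A : Op} {h : ℤ → ℂ} (hA : HasSubdiag A h) {x : ℤ → ℂ}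
    (hx : x.support.Finite) (h1 : ∑' i, ‖x i‖ ^ 2 = 1) : sqForm h x ∈ numRange (A ^ 2) := by
  refine subset_closure ⟨finSeq x hx, ?_, (hA.inner_sq (finSeq x hx)).symm⟩
  rw [← finSeq_norm_sq x hx] at h1
  exact (pow_eq_one_iff_of_nonneg (norm_nonneg _) (by norm_num)).1 h1

lemma tsum_normalize {x : ℤ → ℂ} {N : ℝ} (hN : 0 < N) (h1 : ∑' i, ‖x i‖ ^ 2 = N) :
    ∑' i, ‖((√N)⁻¹ : ℝ) * x i‖ ^ 2 = 1 := by
  simp_rw [norm_mul, mul_pow]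
  rw [tsum_mul_left, h1, Complex.norm_real, Real.norm_of_nonneg (by positivity), inv_pow,
    Real.sq_sqrt hN.le, inv_mul_cancel₀ hN.ne']

lemma sqForm_normalize (h x : ℤ → ℂ) {N : ℝ} (hN : 0 < N) :
    sqForm h (fun i => ((√N)⁻¹ : ℝ) * x i) = sqForm h x / N := by
  rw [sqForm_const_mul, Complex.norm_real, Real.norm_of_nonneg (by positivity), inv_pow,
    Real.sq_sqrt hN.le]
  push_cast
  field_simp

lemma HasSubdiag.sqForm_div_mem {A : Op} {h : ℤ → ℂ} (hA : HasSubdiag A h) {x : ℤ → ℂ}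
    (hx : x.support.Finite) {N : ℝ} (hN : 0 < N) (h1 : ∑' i, ‖x i‖ ^ 2 = N) :
    sqForm h x / N ∈ numRange (A ^ 2) := by
  rw [← sqForm_normalize h x hN]
  exact hA.sqForm_mem (support_const_mul_finite hx _) (tsum_normalize hN h1)

/-! ### Truncated waves and the symbol on the odd sites -/

/-- The `4`-periodic amplitudes `α` at `1` and `β` at `3` modulo `4`. -/
def oddAmp (α β : ℝ) (i : ℤ) : ℝ := if i % 4 = 1 then α else if i % 4 = 3 then β else 0

/-- A truncated quasi-periodic sequence on the odd integers. -/
def oddWave (α β : ℝ) (η : ℂ) (n : ℕ) (i : ℤ) : ℂ :=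
  if 0 ≤ i ∧ i < 4 * n then oddAmp α β i * η ^ (i / 2) else 0

lemma oddWave_of_not_mem {α β : ℝ} {η : ℂ} {n : ℕ} {i : ℤ} (h : ¬(0 ≤ i ∧ i < 4 * n)) :
    oddWave α β η n i = 0 := if_neg h

lemma oddWave_support_finite (α β : ℝ) (η : ℂ) (n : ℕ) : (oddWave α β η n).support.Finite := by
  refine (Set.finite_Ico (0 : ℤ) (4 * n)).subset fun i hi => ?_
  by_contra h
  exact hi (oddWave_of_not_mem h)

lemma tsum_eq_sum_quads {E : Type*} [AddCommGroup E] [TopologicalSpace E] [T2Space E] (n : ℕ)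
    (f : ℤ → E) (hf : ∀ i, ¬(0 ≤ i ∧ i < 4 * (n : ℤ)) → f i = 0) :
    ∑' i, f i = ∑ k ∈ Finset.range n, (f (4 * k) + f (4 * k + 1) + f (4 * k + 2) + f (4 * k + 3)) := by
  have h1 : ∑' i, f i = ∑' m : ℕ, f m := by
    refine (Function.Injective.tsum_eq Nat.cast_injective fun i hi => ?_).symm
    by_contra h
    refine hi (hf i fun h' => h ⟨i.toNat, ?_⟩)
    omega
  rw [h1, tsum_eq_sum (s := Finset.range (4 * n)) fun m hm => hf m ?_]
  · clear h1 hf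
    induction n with
    | zero => simp
    | succ n ih =>
      rw [show 4 * (n + 1) = 4 * n + 1 + 1 + 1 + 1 by ring, Finset.sum_range_succ,
        Finset.sum_range_succ, Finset.sum_range_succ, Finset.sum_range_succ, ih,
        Finset.sum_range_succ]
      push_cast
      simp only [add_assoc]
  · rw [Finset.mem_range] at hm
    omega

lemma oddWave_norm_sq (α β : ℝ) {η : ℂ} (hη : ‖η‖ = 1) (n : ℕ) :
    ∑' i, ‖oddWave α β η n i‖ ^ 2 = n * (α ^ 2 + β ^ 2) := by
  rw [tsum_eq_sum_quads n _ fun i hi => by simp [oddWave_of_not_mem hi]]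
  rw [Finset.sum_congr rfl fun k hk => ?_, Finset.sum_const, Finset.card_range, nsmul_eq_mul]
  rw [Finset.mem_range] at hk
  have e0 : (4 * (k : ℤ)) % 4 = 0 := by omega
  have e1 : (4 * (k : ℤ) + 1) % 4 = 1 := by omega
  have e2 : (4 * (k : ℤ) + 2) % 4 = 2 := by omega
  have e3 : (4 * (k : ℤ) + 3) % 4 = 3 := by omega
  rw [oddWave, if_pos (by omega), oddWave, if_pos (by omega), oddWave, if_pos (by omega),
    oddWave, if_pos (by omega)]
  simp [oddAmp, e0, e1, e2, e3, hη]

lemma zpow_conj_mul {η : ℂ} (hη : ‖η‖ = 1) (a b c : ℤ) (h : b = a + c) :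
    conj (η ^ a) * η ^ b = η ^ c := by
  have h0 : η ≠ 0 := by
    rintro rfl
    simp at hη
  rw [h, zpow_add₀ h0, ← mul_assoc, Complex.conj_mul', norm_zpow, hη]
  simp

lemma perSeq_of_mod (w : Fin 4 → ℂ) (j : ℤ) (m : Fin 4) (h : j % 4 = m) : perSeq w j = w m := by
  rw [perSeq]
  congr 1
  ext
  simp [h]

/-- The wave has `m + 1` periods but only `m` junctions between consecutive periods, hence the two
different factors. The integer power `i / 2` gains one factor `η` per odd site. -/
lemma sqForm_oddWave (w : Fin 4 → ℂ) (α β : ℝ) {η : ℂ} (hη : ‖η‖ = 1) (m : ℕ) :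
    sqForm (perSeq w) (oddWave α β η (m + 1)) =
      (m + 1) * ((w 0 + w 1) * α ^ 2 + (w 2 + w 3) * β ^ 2 + α * β * (η + w 1 * w 2 * conj η)) +
      m * (α * β * (η + w 0 * w 3 * conj η)) := by
  set X := oddWave α β η (m + 1) with hX
  have hin : ∀ i : ℤ, 0 ≤ i → i < 4 * ((m + 1 : ℕ) : ℤ) → X i = oddAmp α β i * η ^ (i / 2) :=
    fun i h1 h2 => if_pos ⟨h1, h2⟩
  have hout : ∀ i : ℤ, ¬(0 ≤ i ∧ i < 4 * ((m + 1 : ℕ) : ℤ)) → X i = 0 := fun i h => if_neg h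
  have hη' : conj η = η ^ (-1 : ℤ) := by
    have := zpow_conj_mul hη 1 0 (-1) (by norm_num)
    simpa using this
  have a1 : ∀ i : ℤ, i % 4 = 1 → oddAmp α β i = α := fun i h => by simp [oddAmp, h]
  have a3 : ∀ i : ℤ, i % 4 = 3 → oddAmp α β i = β := fun i h => by simp [oddAmp, h]
  have a0 : ∀ i : ℤ, i % 4 = 0 ∨ i % 4 = 2 → oddAmp α β i = 0 := fun i h => by
    rcases h with h | h <;> simp [oddAmp, h]
  rw [sqForm, tsum_eq_sum_quads (m + 1) _ fun i hi => by simp [hout i hi]]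
  have hterm : ∀ k ∈ Finset.range (m + 1),
      conj (X (4 * k)) * sqAct (perSeq w) X (4 * k) +
        conj (X (4 * k + 1)) * sqAct (perSeq w) X (4 * k + 1) +
        conj (X (4 * k + 2)) * sqAct (perSeq w) X (4 * k + 2) +
        conj (X (4 * k + 3)) * sqAct (perSeq w) X (4 * k + 3) =
      ((w 0 + w 1) * α ^ 2 + (w 2 + w 3) * β ^ 2 + α * β * (η + w 1 * w 2 * conj η)) +
        ((if k = 0 then 0 else α * β * (w 0 * w 3 * conj η)) +
        (if k = m then 0 else α * β * η)) := by
    intro k hk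
    rw [Finset.mem_range] at hk
    rw [hin (4 * k) (by omega) (by omega), hin (4 * k + 2) (by omega) (by omega),
      a0 (4 * k) (by omega), a0 (4 * k + 2) (by omega), sqAct, sqAct, sqAct, sqAct]
    simp only [Complex.ofReal_zero, zero_mul, map_zero, zero_add, add_zero]
    rw [show 4 * (k : ℤ) + 1 + 2 = 4 * k + 3 by ring, show 4 * (k : ℤ) + 3 - 2 = 4 * k + 1 by ring,
      show 4 * (k : ℤ) + 3 + 2 = 4 * k + 5 by ring, show 4 * (k : ℤ) + 1 - 2 = 4 * k - 1 by ring,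
      show 4 * (k : ℤ) + 3 - 1 = 4 * k + 2 by ring, show 4 * (k : ℤ) + 1 - 1 = 4 * k by ring]
    rw [perSeq_of_mod w (4 * k + 1) 1 (by simp),
      perSeq_of_mod w (4 * k) 0 (by simp),
      perSeq_of_mod w (4 * k - 1) 3 (by simp),
      perSeq_of_mod w (4 * k + 2) 2 (by simp),
      perSeq_of_mod w (4 * k + 3) 3 (by simp)]
    have x1 : X (4 * k + 1) = α * η ^ (2 * k : ℤ) := by
      rw [hin _ (by omega) (by omega), a1 _ (by omega)]
      congr 2; omega
    have x3 : X (4 * k + 3) = β * η ^ (2 * k + 1 : ℤ) := by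
      rw [hin _ (by omega) (by omega), a3 _ (by omega)]
      congr 2; omega
    have x5 : X (4 * k + 5) = if k = m then 0 else α * η ^ (2 * k + 2 : ℤ) := by
      split_ifs with h
      · rw [hout _ (by omega)]
      · rw [hin _ (by omega) (by omega), a1 _ (by omega)]
        congr 2; omega
    have x0 : X (4 * k - 1) = if k = 0 then 0 else β * η ^ (2 * k - 1 : ℤ) := by
      split_ifs with h
      · rw [hout _ (by omega)]
      · rw [hin _ (by omega) (by omega), a3 _ (by omega)]
        congr 2; omega
    rw [x1, x3, x5, x0]
    have c1 := zpow_conj_mul hη (2 * k) (2 * k + 1) 1 (by ring)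
    have c2 := zpow_conj_mul hη (2 * k) (2 * k) 0 (by ring)
    have c3 := zpow_conj_mul hη (2 * k) (2 * k - 1) (-1) (by ring)
    have c4 := zpow_conj_mul hη (2 * k + 1) (2 * k + 2) 1 (by ring)
    have c5 := zpow_conj_mul hη (2 * k + 1) (2 * k + 1) 0 (by ring)
    have c6 := zpow_conj_mul hη (2 * k + 1) (2 * k) (-1) (by ring)
    rw [← hη'] at c3 c6
    rw [zpow_one] at c1 c4
    rw [zpow_zero] at c2 c5
    simp only [map_mul, Complex.conj_ofReal]
    split_ifs
    · linear_combination (α * β) * c1 + (w 1 + w 0) * α ^ 2 * c2 + (w 3 + w 2) * β ^ 2 * c5 +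
        w 2 * w 1 * α * β * c6
    · linear_combination (α * β) * c1 + (w 1 + w 0) * α ^ 2 * c2 + (w 3 + w 2) * β ^ 2 * c5 +
        w 2 * w 1 * α * β * c6 + α * β * c4
    · linear_combination (α * β) * c1 + (w 1 + w 0) * α ^ 2 * c2 + (w 3 + w 2) * β ^ 2 * c5 +
        w 2 * w 1 * α * β * c6 + w 0 * w 3 * α * β * c3
    · linear_combination (α * β) * c1 + (w 1 + w 0) * α ^ 2 * c2 + (w 3 + w 2) * β ^ 2 * c5 +
        w 2 * w 1 * α * β * c6 + w 0 * w 3 * α * β * c3 + α * β * c4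
  have s1 : ∀ c : ℂ, ∑ k ∈ Finset.range (m + 1), (if k = 0 then 0 else c) = m * c := fun c => by
    simp [Finset.sum_range_succ']
  have s2 : ∀ c : ℂ, ∑ k ∈ Finset.range (m + 1), (if k = m then 0 else c) = m * c := fun c => by
    rw [Finset.sum_range_succ, if_pos rfl, add_zero,
      Finset.sum_congr rfl fun k hk => if_neg (Finset.mem_range.1 hk).ne]
    simp
  rw [Finset.sum_congr rfl hterm, Finset.sum_add_distrib]
  conv_lhs => arg 2; rw [Finset.sum_add_distrib]
  rw [s1, s2]
  simp only [Finset.sum_const, Finset.card_range, nsmul_eq_mul]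
  push_cast
  ring

/-- Values of the symbol of `perOp w ^ 2` on the odd integers belong to the numerical range. -/
lemma symbol_mem_numRange (w : Fin 4 → ℂ) {α β : ℝ} (hαβ : α ^ 2 + β ^ 2 = 1) {η : ℂ}
    (hη : ‖η‖ = 1) :
    (w 0 + w 1) * α ^ 2 + (w 2 + w 3) * β ^ 2 +
      α * β * (2 * η + (w 1 * w 2 + w 0 * w 3) * conj η) ∈ numRange (perOp w ^ 2) := by
  set c : ℂ := α * β * (η + w 0 * w 3 * conj η) with hc
  set V : ℂ := (w 0 + w 1) * α ^ 2 + (w 2 + w 3) * β ^ 2 +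
      α * β * (2 * η + (w 1 * w 2 + w 0 * w 3) * conj η) with hV
  -- The one missing junction costs `c / (m + 1)` after normalisation.
  have hlim : Filter.Tendsto (fun m : ℕ => V - c * (1 / ((m : ℂ) + 1))) Filter.atTop
      (nhds (V - c * 0)) :=
    tendsto_const_nhds.sub (tendsto_one_div_add_atTop_nhds_zero_nat.const_mul c)
  rw [mul_zero, sub_zero] at hlim
  refine isClosed_closure.mem_of_tendsto hlim (Filter.Eventually.of_forall fun m => ?_)
  have hpos : (0 : ℝ) < ((m + 1 : ℕ) : ℝ) := by positivity
  have := (hasSubdiag_perOp w).sqForm_div_mem (oddWave_support_finite α β η (m + 1)) hpos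
    (by rw [oddWave_norm_sq α β hη, hαβ, mul_one])
  rw [sqForm_oddWave w α β hη] at this
  refine Set.mem_of_eq_of_mem ?_ this
  have h0 : (m : ℂ) + 1 ≠ 0 := Nat.cast_add_one_ne_zero m
  rw [hV, hc]
  push_cast
  field_simp
  ring

/-! ### Ellipses and circle inside the periodic ranges -/

lemma add_ellipse_mem (s : ℂ) {ζ : ℂ} (hζ : ‖ζ‖ = 1) :
    2 * s + (ζ + s ^ 2 * conj ζ) ∈ numRange (perOp ![s, s, s, s] ^ 2) := by
  have h2 : (√(1 / 2) : ℝ) ^ 2 = 1 / 2 := Real.sq_sqrt (by norm_num)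
  have h := symbol_mem_numRange ![s, s, s, s] (α := √(1 / 2)) (β := √(1 / 2))
    (by rw [h2]; norm_num) hζ
  have h3 : ((√(1 / 2) : ℝ) : ℂ) ^ 2 = 1 / 2 := by
    rw [← Complex.ofReal_pow, h2]
    norm_num
  refine Set.mem_of_eq_of_mem ?_ h
  simp only [Matrix.cons_val]
  linear_combination (-(4 * s + 2 * ζ + 2 * s ^ 2 * conj ζ)) * h3

lemma exists_norm_one_mul (z : ℂ) : ∃ η : ℂ, ‖η‖ = 1 ∧ z = ‖z‖ * η := by
  by_cases h : z = 0
  · exact ⟨1, by simp, by simp [h]⟩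
  · have h' : (‖z‖ : ℂ) ≠ 0 := by simpa using h
    exact ⟨z / ‖z‖, by simp [h], by field_simp⟩

/-- With this period every link between odd sites has opposite signs. Putting `C = β ^ 2 - α ^ 2`
and `g = 2 * α * β * η`, the symbol value is `2 * σ * C + g - σ ^ 2 * conj g` on the sphere `C ^ 2 +
‖g‖ ^ 2 = 1`. -/
lemma circle_mem (σ : ℝ) {ζ : ℂ} (hζ : ‖ζ‖ = 1) :
    ((1 + σ ^ 2 : ℝ) : ℂ) * ζ ∈ numRange (perOp ![-(σ : ℂ), -σ, σ, σ] ^ 2) := by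
  have hR : (1 + σ ^ 2 : ℝ) ≠ 0 := by positivity
  -- The pair `(C, g.re)` is `ζ.re` times the unit vector along `(2 * σ, 1 - σ ^ 2)`, the equality
  -- case of Cauchy–Schwarz for the real part of the symbol.
  set C : ℝ := 2 * σ * ζ.re / (1 + σ ^ 2) with hC
  set g : ℂ := ⟨(1 - σ ^ 2) * ζ.re / (1 + σ ^ 2), ζ.im⟩ with hg
  have hCR : C * (1 + σ ^ 2) = 2 * σ * ζ.re := div_mul_cancel₀ _ hR
  have hgR : g.re * (1 + σ ^ 2) = (1 - σ ^ 2) * ζ.re := div_mul_cancel₀ _ hR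
  have hgi : g.im = ζ.im := rfl
  have hζ2 : ζ.re ^ 2 + ζ.im ^ 2 = 1 := by
    have := Complex.sq_norm ζ
    rw [hζ, Complex.normSq_apply] at this
    linarith
  have hCg : C ^ 2 + ‖g‖ ^ 2 = 1 := by
    rw [Complex.sq_norm, Complex.normSq_apply, hg, hC]
    field_simp
    linear_combination (1 + σ ^ 2) ^ 2 * hζ2
  clear_value C g
  obtain ⟨η, hη, hgη⟩ := exists_norm_one_mul g
  have hC1 : |C| ≤ 1 := by
    rw [← sq_le_one_iff_abs_le_one]
    nlinarith [sq_nonneg ‖g‖]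
  obtain ⟨hC2, hC3⟩ := abs_le.1 hC1
  have hα : √((1 - C) / 2) ^ 2 = (1 - C) / 2 := Real.sq_sqrt (by linarith)
  have hβ : √((1 + C) / 2) ^ 2 = (1 + C) / 2 := Real.sq_sqrt (by linarith)
  have hαβ : 2 * (√((1 - C) / 2) * √((1 + C) / 2)) = ‖g‖ := by
    rw [← Real.sqrt_mul (by linarith), show (1 - C) / 2 * ((1 + C) / 2) = (‖g‖ / 2) ^ 2 by
      linear_combination (-1 / 4) * hCg, Real.sqrt_sq (by positivity)]
    ring
  have h := symbol_mem_numRange ![-(σ : ℂ), -σ, σ, σ] (α := √((1 - C) / 2))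
    (β := √((1 + C) / 2)) (by rw [hα, hβ]; ring) hη
  convert h using 1
  rw [← Complex.ofReal_pow, ← Complex.ofReal_pow, hα, hβ]
  have e1 : ((√((1 - C) / 2) : ℝ) : ℂ) * ((√((1 + C) / 2) : ℝ) : ℂ) = ‖g‖ / 2 := by
    rw [← Complex.ofReal_mul, ← hαβ]
    push_cast
    ring
  have e2 : (‖g‖ : ℂ) * conj η = conj g := by
    nth_rewrite 2 [hgη]
    simp
  rw [e1]
  simp only [Matrix.cons_val]
  rw [show (-(σ : ℂ) + -σ) * ((1 - C) / 2 : ℝ) + (σ + σ) * ((1 + C) / 2 : ℝ) +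
      (‖g‖ : ℂ) / 2 * (2 * η + (-(σ : ℂ) * σ + -(σ : ℂ) * σ) * conj η) =
      2 * σ * C + (‖g‖ * η - σ ^ 2 * (‖g‖ * conj η)) by push_cast; ring, ← hgη, e2]
  apply Complex.ext
  · have e : (1 + σ ^ 2) * ζ.re = 2 * σ * C + (g.re - σ ^ 2 * g.re) := by
      apply mul_right_cancel₀ hR
      linear_combination (-2 * σ) * hCR - (1 - σ ^ 2) * hgR
    simpa [pow_two] using e
  · simp [pow_two, hgi]
    ring

/-! ### Compact hull and separation -/

/-- In a finite-dimensional space, the convex hull of a compact set is compact. -/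
lemma isCompact_convexHull_of_finiteDimensional {E : Type*} [NormedAddCommGroup E]
    [NormedSpace ℝ E] [FiniteDimensional ℝ E] {s : Set E} (hs : IsCompact s) :
    IsCompact (convexHull ℝ s) := by
  set n := Module.finrank ℝ E + 1
  have hK : IsCompact (stdSimplex ℝ (Fin n) ×ˢ Set.pi Set.univ fun _ : Fin n => s) :=
    (isCompact_stdSimplex ℝ (Fin n)).prod (isCompact_univ_pi fun _ => hs)
  have hf : Continuous fun p : (Fin n → ℝ) × (Fin n → E) => ∑ i, p.1 i • p.2 i := by fun_prop
  convert hK.image hf using 1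
  apply Set.Subset.antisymm
  · intro x hx
    -- Carathéodory: at most `n` points suffice. Unused slots get weight zero and the arbitrary
    -- point `z i₀`.
    obtain ⟨ι, _, z, w, hz, hi, hw, hw1, hx⟩ := eq_pos_convex_span_of_mem_convexHull hx
    have hcard : Fintype.card ι ≤ Fintype.card (Fin n) := by
      rw [Fintype.card_fin]
      exact hi.card_le_finrank_succ.trans (Nat.succ_le_succ (Submodule.finrank_le _))
    obtain ⟨e⟩ := Function.Embedding.nonempty_of_card_le hcard
    have hne : Nonempty ι := by
      by_contra h
      rw [not_nonempty_iff] at h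
      simp at hw1
    obtain ⟨i₀⟩ := hne
    have h0 : ∀ j ∉ Set.range e, Function.extend e w 0 j = 0 := fun j hj =>
      Function.extend_apply' _ _ _ hj
    refine ⟨(Function.extend e w 0, Function.extend e z fun _ => z i₀),
      ⟨⟨fun j => ?_, ?_⟩, fun j _ => ?_⟩, ?_⟩
    · by_cases hj : j ∈ Set.range e
      · obtain ⟨i, rfl⟩ := hj
        change 0 ≤ Function.extend e w 0 (e i)
        rw [e.injective.extend_apply]
        exact (hw i).le
      · exact (h0 j hj).ge
    · rw [← hw1]
      refine (Fintype.sum_of_injective e e.injective _ _ h0 fun i => ?_).symm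
      exact (e.injective.extend_apply _ _ _).symm
    · by_cases hj : j ∈ Set.range e
      · obtain ⟨i, rfl⟩ := hj
        change Function.extend e z (fun _ => z i₀) (e i) ∈ s
        rw [e.injective.extend_apply]
        exact hz (Set.mem_range_self i)
      · change Function.extend e z (fun _ => z i₀) j ∈ s
        rw [Function.extend_apply' _ _ _ hj]
        exact hz (Set.mem_range_self i₀)
    · rw [← hx]
      refine (Fintype.sum_of_injective e e.injective _ _ (fun j hj => ?_) fun i => ?_).symm
      · change Function.extend e w 0 j • _ = _
        rw [h0 j hj, zero_smul]
      · change _ = Function.extend e w 0 (e i) • Function.extend e z (fun _ => z i₀) (e i)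
        rw [e.injective.extend_apply, e.injective.extend_apply]
  · rintro _ ⟨⟨w, z⟩, ⟨⟨hw, hw1⟩, hz⟩, rfl⟩
    exact (convex_convexHull ℝ s).sum_mem (fun i _ => hw i) hw1
      fun i _ => subset_convexHull ℝ s (hz i trivial)

lemma isCompact_numRange (A : Op) : IsCompact (numRange A) := by
  refine Bornology.IsBounded.isCompact_closure ?_
  refine (Metric.isBounded_iff_subset_closedBall 0).2 ⟨‖A‖, ?_⟩
  rintro _ ⟨x, hx, rfl⟩
  rw [mem_closedBall_zero_iff]
  calc ‖inner ℂ x (A x)‖ ≤ ‖x‖ * ‖A x‖ := norm_inner_le_norm _ _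
    _ ≤ ‖x‖ * (‖A‖ * ‖x‖) := by gcongr; exact A.le_opNorm x
    _ = ‖A‖ := by rw [hx]; ring

lemma exists_re_conj_mul (f : ℂ →L[ℝ] ℝ) : ∃ w : ℂ, ∀ z, f z = (conj w * z).re := by
  refine ⟨⟨f 1, f Complex.I⟩, fun z => ?_⟩
  have hz : z = z.re • (1 : ℂ) + z.im • Complex.I := by
    simp [Complex.re_add_im]
  conv_lhs => rw [hz, map_add, map_smul, map_smul]
  simp
  ring

lemma numRange_sq_subset {σ : ℝ} (hσ : 0 ≤ σ) {A : Op} {h : ℤ → ℂ} (hA : HasSubdiag A h)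
    (hh : ∀ j, h j = σ ∨ h j = -σ) :
    numRange (A ^ 2) ⊆ convexHull ℝ (numRange (perOp ![(σ : ℂ), σ, σ, σ] ^ 2) ∪
      numRange (perOp ![-(σ : ℂ), -σ, σ, σ] ^ 2) ∪
      numRange (perOp ![-(σ : ℂ), -σ, -σ, -σ] ^ 2)) := by
  set U := numRange (perOp ![(σ : ℂ), σ, σ, σ] ^ 2) ∪
      numRange (perOp ![-(σ : ℂ), -σ, σ, σ] ^ 2) ∪
      numRange (perOp ![-(σ : ℂ), -σ, -σ, -σ] ^ 2)
  have hU : IsClosed (convexHull ℝ U) :=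
    (isCompact_convexHull_of_finiteDimensional (((isCompact_numRange _).union
      (isCompact_numRange _)).union (isCompact_numRange _))).isClosed
  refine closure_minimal ?_ hU
  rintro _ ⟨x, hx, rfl⟩
  rw [hA.inner_sq]
  by_contra hz
  obtain ⟨f, u, hfu, huf⟩ := geometric_hahn_banach_closed_point (convex_convexHull ℝ U) hU hz
  obtain ⟨w, hw⟩ := exists_re_conj_mul f
  have hmem : ∀ z ∈ U, (conj w * z).re < u := fun z hz => by
    rw [← hw]
    exact hfu z (subset_convexHull ℝ U hz)
  -- The point of the centred ellipse that is extremal in direction `w`.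
  have hp : ∃ ζ : ℂ, ‖ζ‖ = 1 ∧
      (conj w * (ζ + σ ^ 2 * conj ζ)).re = ‖conj w + σ ^ 2 * w‖ := by
    obtain ⟨η, hη, e⟩ := exists_norm_one_mul (conj w + σ ^ 2 * w)
    refine ⟨conj η, by simpa using hη, ?_⟩
    have e1 : (conj w * (conj η + σ ^ 2 * conj (conj η))).re =
        ((conj w + σ ^ 2 * w) * conj η).re := by
      simp only [pow_two, Complex.add_re, Complex.mul_re, Complex.mul_im, Complex.conj_re,
        Complex.conj_im, Complex.add_im, Complex.ofReal_re, Complex.ofReal_im]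
      ring
    rw [e1]
    nth_rewrite 1 [e]
    rw [mul_assoc, Complex.mul_conj', hη]
    simp
  obtain ⟨ζ, hζ, hpζ⟩ := hp
  have hpos := hmem _ (Or.inl (Or.inl (add_ellipse_mem σ hζ)))
  have hneg := hmem _ (Or.inr (add_ellipse_mem (-(σ : ℂ)) hζ))
  have hcirc : (1 + σ ^ 2) * ‖w‖ < u := by
    obtain ⟨η, hη, e⟩ := exists_norm_one_mul w
    have := hmem _ (Or.inl (Or.inr (circle_mem σ hη)))
    convert this using 1
    nth_rewrite 2 [e]
    rw [map_mul, Complex.conj_ofReal, show (‖w‖ : ℂ) * conj η * ((1 + σ ^ 2 : ℝ) * η) =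
      ((‖w‖ * (1 + σ ^ 2) : ℝ) : ℂ) * (conj η * η) by push_cast; ring, Complex.conj_mul', hη]
    simp only [Complex.ofReal_one, one_pow, mul_one, Complex.ofReal_re]
    ring
  rw [neg_sq, mul_add, Complex.add_re, hpζ] at hneg
  rw [mul_add, Complex.add_re, hpζ] at hpos
  have hell : 2 * σ * |w.re| + ‖conj w + σ ^ 2 * w‖ < u := by
    simp at hpos hneg
    rcases abs_cases w.re with ⟨h1, _⟩ | ⟨h1, _⟩ <;> rw [h1] <;> linarith
  have := re_sqForm_le hσ hh w u hell.le hcirc.le x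
  rw [hx, one_pow, mul_one, ← hw] at this
  linarith

/-! ### Translation, gluing and convexity -/

lemma sqForm_shift (h x : ℤ → ℂ) (D : ℤ) :
    sqForm (fun i => h (i - D)) (fun i => x (i - D)) = sqForm h x := by
  rw [sqForm, sqForm, ← (Equiv.subRight D).tsum_eq fun i => conj (x i) * sqAct h x i]
  refine tsum_congr fun i => ?_
  simp only [sqAct, Equiv.subRight_apply]
  rw [show i + 2 - D = i - D + 2 by ring, show i - 1 - D = i - D - 1 by ring,
    show i - 2 - D = i - D - 2 by ring]

lemma support_shift_finite {x : ℤ → ℂ} (hx : x.support.Finite) (D : ℤ) :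
    (fun i => x (i - D)).support.Finite :=
  hx.preimage (sub_left_injective (b := D)).injOn

lemma tsum_shift (x : ℤ → ℂ) (D : ℤ) : ∑' i, ‖x (i - D)‖ ^ 2 = ∑' i, ‖x i‖ ^ 2 :=
  (Equiv.subRight D).tsum_eq fun i => ‖x i‖ ^ 2

lemma sqForm_congr {h h' x : ℤ → ℂ}
    (H : ∀ i, x i ≠ 0 → h i = h' i ∧ h (i - 1) = h' (i - 1) ∧ h (i - 2) = h' (i - 2)) :
    sqForm h x = sqForm h' x := by
  refine tsum_congr fun i => ?_
  by_cases hi : x i = 0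
  · simp [hi]
  · obtain ⟨h0, h1, h2⟩ := H i hi
    rw [sqAct, sqAct, h0, h1, h2]

lemma sqForm_summable (h : ℤ → ℂ) {x : ℤ → ℂ} (hx : x.support.Finite) :
    Summable fun i => conj (x i) * sqAct h x i := by
  refine summable_of_hasFiniteSupport (hx.subset fun i hi => ?_)
  contrapose! hi
  simp [Function.notMem_support.1 hi]

lemma norm_sq_summable {x : ℤ → ℂ} (hx : x.support.Finite) : Summable fun i => ‖x i‖ ^ 2 :=
  (norm_sq_hasSum (finSeq x hx)).summable

/-- The form has range two, so no cross terms survive the gap between the supports. -/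
lemma sqForm_add_of_separated (h : ℤ → ℂ) {x y : ℤ → ℂ} (hx : x.support.Finite)
    (hy : y.support.Finite) {a : ℤ} (hxa : ∀ i, a ≤ i → x i = 0) (hya : ∀ i, i < a + 2 → y i = 0) :
    sqForm h (fun i => x i + y i) = sqForm h x + sqForm h y := by
  rw [sqForm, sqForm, sqForm, ← (sqForm_summable h hx).tsum_add (sqForm_summable h hy)]
  refine tsum_congr fun i => ?_
  simp only [sqAct, map_add]
  by_cases hi : i < a
  · rw [hya i (by omega), hya (i + 2) (by omega), hya (i - 2) (by omega)]
    simp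
  · rw [hxa i (by omega)]
    by_cases hi' : i < a + 2
    · rw [hya i hi']
      simp
    · rw [hxa (i - 2) (by omega), hxa (i + 2) (by omega)]
      simp

lemma tsum_add_of_separated {x y : ℤ → ℂ} (hx : x.support.Finite)
    (hy : y.support.Finite) {a : ℤ} (hxa : ∀ i, a ≤ i → x i = 0) (hya : ∀ i, i < a → y i = 0) :
    ∑' i, ‖x i + y i‖ ^ 2 = ∑' i, ‖x i‖ ^ 2 + ∑' i, ‖y i‖ ^ 2 := by
  rw [← (norm_sq_summable hx).tsum_add (norm_sq_summable hy)]
  refine tsum_congr fun i => ?_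
  by_cases hi : i < a
  · simp [hya i hi]
  · simp [hxa i (by omega)]

/-- The values of the quadratic forms of the squares of all operators with entries `±σ` on the
subdiagonal at finitely supported unit vectors. -/
def finValues (σ : ℝ) : Set ℂ :=
  {z | ∃ h x : ℤ → ℂ, (∀ j, h j = σ ∨ h j = -σ) ∧ x.support.Finite ∧ ∑' i, ‖x i‖ ^ 2 = 1 ∧
    z = sqForm h x}

lemma exists_support_bound {x : ℤ → ℂ} (hx : x.support.Finite) :
    ∃ N : ℕ, ∀ i, x i ≠ 0 → -N ≤ i ∧ i ≤ N := by
  refine ⟨hx.toFinset.sup Int.natAbs, fun i hi => ?_⟩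
  have := Finset.le_sup (f := Int.natAbs) (hx.mem_toFinset.2 hi)
  omega

lemma convex_finValues (σ : ℝ) : Convex ℝ (finValues σ) := by
  rw [convex_iff_forall_pos]
  rintro _ ⟨h, x, hh, hx, hx1, rfl⟩ _ ⟨h', x', hh', hx', hx1', rfl⟩ a b ha hb hab
  obtain ⟨N, hN⟩ := exists_support_bound hx
  obtain ⟨N', hN'⟩ := exists_support_bound hx'
  set D : ℤ := N + N' + 10 with hD
  set y : ℤ → ℂ := fun i => x' (i - D) with hy
  have hys : y.support.Finite := support_shift_finite hx' D
  have hxa : ∀ i : ℤ, (N : ℤ) + 1 ≤ i → ((√a : ℝ) : ℂ) * x i = 0 := fun i hi => by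
    by_contra hne
    have := hN i (right_ne_zero_of_mul hne)
    omega
  have hyN : ∀ i : ℤ, y i ≠ 0 → (N : ℤ) + 10 ≤ i := fun i hi => by
    have := hN' _ hi
    omega
  have hya : ∀ i : ℤ, i < (N : ℤ) + 1 + 2 → ((√b : ℝ) : ℂ) * y i = 0 := fun i hi => by
    by_contra hne
    have := hyN i (right_ne_zero_of_mul hne)
    omega
  have hxf := support_const_mul_finite hx (√a : ℝ)
  have hyf := support_const_mul_finite hys (√b : ℝ)
  have hsq : ∀ t : ℝ, 0 ≤ t → ‖((√t : ℝ) : ℂ)‖ ^ 2 = t := fun t ht => by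
    rw [Complex.norm_real, Real.norm_of_nonneg (Real.sqrt_nonneg _), Real.sq_sqrt ht]
  -- The form reads `h` at `i`, `i - 1` and `i - 2` for `i` in the support. The first vector lives
  -- on `i ≤ N` and the second on `i ≥ N + 10`, so each sees only its own pattern across the cut at
  -- `N + 4`.
  refine ⟨fun i => if i < N + 4 then h i else h' (i - D),
    fun i => ((√a : ℝ) : ℂ) * x i + ((√b : ℝ) : ℂ) * y i, fun j => ?_,
    (hxf.union hyf).subset (Function.support_add _ _), ?_, ?_⟩
  · dsimp only
    split_ifs
    exacts [hh _, hh' _]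
  · rw [tsum_add_of_separated hxf hyf hxa fun i hi => hya i (by omega)]
    simp_rw [norm_mul, mul_pow]
    rw [tsum_mul_left, tsum_mul_left, hx1, tsum_shift x' D, hx1', hsq a ha.le, hsq b hb.le]
    linarith
  · rw [sqForm_add_of_separated _ hxf hyf hxa hya, sqForm_const_mul, sqForm_const_mul,
      hsq a ha.le, hsq b hb.le, Complex.real_smul, Complex.real_smul]
    congr 2
    · refine sqForm_congr fun i hi => ?_
      have := hN i hi
      rw [if_pos (by omega), if_pos (by omega), if_pos (by omega)]
      exact ⟨rfl, rfl, rfl⟩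
    · rw [← sqForm_shift h' x' D]
      refine sqForm_congr fun i hi => ?_
      have := hyN i hi
      rw [if_neg (by omega), if_neg (by omega), if_neg (by omega)]
      exact ⟨rfl, rfl, rfl⟩

/-! ### Pseudo-ergodicity and approximation -/

lemma norm_entry_le_toEuclideanCLM {N : ℕ} (M : Matrix (Fin N) (Fin N) ℂ) (i j : Fin N) :
    ‖M i j‖ ≤ ‖Matrix.toEuclideanCLM (n := Fin N) (𝕜 := ℂ) M‖ := by
  have h1 := (Matrix.toEuclideanCLM (n := Fin N) (𝕜 := ℂ) M).le_opNorm
    (WithLp.toLp 2 (Pi.single j 1))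
  have h2 := PiLp.norm_apply_le (Matrix.toEuclideanCLM (n := Fin N) (𝕜 := ℂ) M
    (WithLp.toLp 2 (Pi.single j 1))) i
  have h3 : ‖(WithLp.toLp 2 (Pi.single j 1) : EuclideanSpace ℂ (Fin N))‖ = 1 := by
    have := PiLp.norm_single (p := 2) (β := fun _ : Fin N => ℂ) j 1
    rw [norm_one] at this
    exact this
  rw [h3, mul_one] at h1
  refine le_trans (le_of_eq ?_) (h2.trans h1)
  rw [Matrix.toEuclideanCLM_toLp]
  simp

lemma exists_pattern {σ : ℝ} (hσ : 0 < σ) {A : Op} (hA : A ∈ pseudoErgodic (-1) 1 (hopSets σ))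
    {h : ℤ → ℂ} (hh : ∀ j, h j = σ ∨ h j = -σ) (N : ℕ) :
    ∃ D : ℤ, ∀ i : ℤ, -N ≤ i → i ≤ N → entry A (i + D + 1) (i + D) = h i := by
  -- The `2 * N + 1` subdiagonal entries indexed from `-N` to `N` need a block with one more row.
  set B : Matrix (Fin (2 * N + 2)) (Fin (2 * N + 2)) ℂ := fun i j =>
    if (j : ℕ) = i + 1 then 1 else if (i : ℕ) = j + 1 then h ((j : ℕ) - N) else 0 with hB
  have hBmem : B ∈ finBandClass (-1) 1 (hopSets σ) (2 * N + 2) := by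
    intro i j
    refine ⟨fun hk => ?_, fun hk => ?_⟩
    · obtain e | e | e : (i : ℤ) - j = -1 ∨ (i : ℤ) - j = 0 ∨ (i : ℤ) - j = 1 := by omega
      · rw [e, hB]
        simp only
        rw [if_pos (by omega)]
        simp [hopSets]
      · rw [e, hB]
        simp only
        rw [if_neg (by omega), if_neg (by omega)]
        simp [hopSets]
      · rw [e, hB]
        simp only
        rw [if_neg (by omega), if_pos (by omega)]
        simpa [hopSets] using hh _
    · rw [hB]
      simp only
      rw [if_neg (by omega), if_neg (by omega)]
  -- Distinct admissible entries differ by `2 * σ`, so the tolerance `σ` already forces equality.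
  obtain ⟨k, hk⟩ := hA.2 σ hσ _ B hBmem
  refine ⟨k + N, fun i hi hi' => ?_⟩
  have hj : (i + N).toNat < 2 * N + 2 := by omega
  have hj' : (i + N).toNat + 1 < 2 * N + 2 := by omega
  have h1 := (norm_entry_le_toEuclideanCLM _ ⟨_, hj'⟩ ⟨_, hj⟩).trans hk
  rw [Matrix.sub_apply, diagBlock, Matrix.of_apply, hB] at h1
  simp only [Nat.cast_add, Nat.cast_one] at h1
  rw [if_neg (by omega), if_true, show ((i + N).toNat : ℤ) = i + N by omega] at h1
  rw [show k + (i + N + 1) = i + (k + N) + 1 by ring, show k + (i + N) = i + (k + N) by ring,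
    show i + N - N = i by ring] at h1
  have h2 : ‖(σ : ℂ) + σ‖ = 2 * σ := by
    rw [← two_mul, norm_mul, Complex.norm_real, Real.norm_of_nonneg hσ.le]
    simp
  rcases entry_eq_or_neg hA.1 (i + (k + N)) with e | e <;> rcases hh i with e' | e' <;>
    rw [e, e'] at h1 ⊢
  · rw [sub_neg_eq_add, h2] at h1
    linarith
  · rw [← neg_add', norm_neg, h2] at h1
    linarith

lemma finValues_subset_numRange {σ : ℝ} (hσ : 0 < σ) {A : Op}
    (hA : A ∈ pseudoErgodic (-1) 1 (hopSets σ)) : finValues σ ⊆ numRange (A ^ 2) := by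
  rintro _ ⟨h, x, hh, hx, hx1, rfl⟩
  obtain ⟨N, hN⟩ := exists_support_bound hx
  obtain ⟨D, hD⟩ := exists_pattern hσ hA hh (N + 2)
  have e : sqForm h x = sqForm (fun j => entry A (j + 1) j) (fun i => x (i - D)) := by
    rw [← sqForm_shift h x D]
    refine (sqForm_congr fun i hi => ?_).symm
    have := hN _ hi
    have key : ∀ j : ℤ, i - 2 ≤ j → j ≤ i → entry A (j + 1) j = h (j - D) := fun j h1 h2 => by
      rw [← hD (j - D) (by push_cast; omega) (by push_cast; omega), sub_add_cancel]
    exact ⟨key _ (by omega) (by omega), key _ (by omega) (by omega), key _ (by omega) (by omega)⟩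
  rw [e]
  exact (hasSubdiag_of_mem hA.1).sqForm_mem (support_shift_finite hx D) (by rw [tsum_shift, hx1])

/-- Finite truncations of a unit vector converge to it in norm, and their normalised form values
converge by continuity. -/
lemma numRange_subset_closure_finValues {σ : ℝ} {B : Op} {h : ℤ → ℂ} (hB : HasSubdiag B h)
    (hh : ∀ j, h j = σ ∨ h j = -σ) : numRange (B ^ 2) ⊆ closure (finValues σ) := by
  refine closure_minimal ?_ isClosed_closure
  rintro _ ⟨x, hx, rfl⟩
  have h1 : HasSum (fun j => lp.single 2 j ((x : ℤ → ℂ) j)) x :=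
    lp.hasSum_single (by norm_num) x
  rw [HasSum, SummationFilter.unconditional_filter] at h1
  set y : Finset ℤ → ℓ²(ℤ, ℂ) := fun s => ∑ j ∈ s, lp.single 2 j ((x : ℤ → ℂ) j)
  have hn : Filter.Tendsto (fun s => ‖y s‖ ^ 2) Filter.atTop (nhds 1) := by
    have := (h1.norm).pow 2
    rwa [hx, one_pow] at this
  have hq : Filter.Tendsto (fun s => inner ℂ (y s) ((B ^ 2) (y s)) / ((‖y s‖ ^ 2 : ℝ) : ℂ))
      Filter.atTop (nhds (inner ℂ x ((B ^ 2) x))) := by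
    have h2 := (h1.inner (𝕜 := ℂ) (((B ^ 2).continuous.tendsto x).comp h1)).div
      ((Complex.continuous_ofReal.tendsto _).comp hn) (by simp)
    rw [Complex.ofReal_one, div_one] at h2
    exact h2
  refine mem_closure_of_tendsto hq ?_
  filter_upwards [hn.eventually (lt_mem_nhds zero_lt_one)] with s hs
  have hfin : (y s : ℤ → ℂ).support.Finite := by
    refine s.finite_toSet.subset fun i hi => ?_
    by_contra his
    refine hi ?_
    rw [lp.coeFn_sum, Finset.sum_apply]
    refine Finset.sum_eq_zero fun j hj => lp.single_apply_ne 2 j _ ?_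
    rintro rfl
    exact his hj
  have hN := (norm_sq_hasSum (y s)).tsum_eq
  rw [hB.inner_sq, ← sqForm_normalize h _ hs]
  exact ⟨h, _, hh, support_const_mul_finite hfin _, tsum_normalize hs hN, rfl⟩

lemma perSeq_eq_or_neg {σ : ℝ} {w : Fin 4 → ℂ} (hw : ∀ k, w k = σ ∨ w k = -σ) (j : ℤ) :
    perSeq w j = σ ∨ perSeq w j = -σ := hw _

end

theorem theoremN (σ : ℝ) (hσ : σ ∈ Set.Ioc (0 : ℝ) 1) (B₁ B₂ B₃ : Op)
    (hB₁ : B₁ = perOp ![(σ : ℂ), σ, σ, σ])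
    (hB₂ : B₂ = perOp ![-(σ : ℂ), -σ, σ, σ])
    (hB₃ : B₃ = perOp ![-(σ : ℂ), -σ, -σ, -σ]) :
    (∀ A ∈ bandClass (-1) 1 (hopSets σ),
      numRange (A ^ 2) ⊆
        convexHull ℝ (numRange (B₁ ^ 2) ∪ numRange (B₂ ^ 2) ∪ numRange (B₃ ^ 2))) ∧
    (∀ A ∈ pseudoErgodic (-1) 1 (hopSets σ),
      numRange (A ^ 2) =
        convexHull ℝ (numRange (B₁ ^ 2) ∪ numRange (B₂ ^ 2) ∪ numRange (B₃ ^ 2))) := by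
  subst hB₁ hB₂ hB₃
  have hsub : ∀ A ∈ bandClass (-1) 1 (hopSets σ), numRange (A ^ 2) ⊆ _ := fun A hA =>
    numRange_sq_subset hσ.1.le (hasSubdiag_of_mem hA) (entry_eq_or_neg hA)
  refine ⟨hsub, fun A hA => (hsub A hA.1).antisymm ?_⟩
  have hper : ∀ w : Fin 4 → ℂ, (∀ k, w k = σ ∨ w k = -σ) →
      numRange (perOp w ^ 2) ⊆ closure (finValues σ) := fun w hw =>
    numRange_subset_closure_finValues (hasSubdiag_perOp w) (perSeq_eq_or_neg hw)
  -- The closure of `finValues σ` is convex and contains the three ranges, so it contains their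
  -- hull; it lies in the closed set `numRange (A ^ 2)`.
  refine (convexHull_min (Set.union_subset (Set.union_subset (hper _ ?_) (hper _ ?_))
    (hper _ ?_)) (convex_finValues σ).closure).trans
    (closure_minimal (finValues_subset_numRange hσ.1 hA) isClosed_closure)
  all_goals
    intro k
    fin_cases k <;> simp
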